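/- **Setting.** Let $n,m$ be positive integers with $m$ even. Let $U\subset\mathbb R^n$ be a bounded domain (non-empty, open, connected) whose boundary $S=\partial U$ is smooth, i.e. near each of its points $S$ is a smooth hypersurface with $U$ on one side (so $S$ consists of finitely many smooth closed hypersurfaces). Let $$A(x,\partial/\partial x)=\sum_{|\alpha|\le m}a_\alpha(x)D^\alpha$$ be a linear differential operator with real coefficients continuous on $\overline U$ that is elliptic of order $m$: $\sum_{|\alpha|=m}a_\alpha(x)\xi^\alpha\neq0$ for all $x\in\overline U$ and $0\ne\xi\in\mathbb R^n$. Let $B_1,\dots,B_{m/2}$ be linear differential operators with real coefficients continuous on $S$, of pairwise distinct orders $m_j<m$, such that at every $x\in S$ the normal direction is not characteristic for any $B_j$. All functions are real-valued. Put $$\mathcal D(A)=\{u\in H^m(U): B_j(x,\partial/\partial x)u=0 \text{ on } S \text{ in the sense of traces},\ j=1,\dots,m/2\}.$$ The collection $(U,A,B_1,\dots,B_{m/2})$ is *admissible* if $A$ maps $\mathcal D(A)$ one-to-one onto $L^2(U)$ and the Green's operator $G=A^{-1}$ is self-adjoint in $L^2(U)$. It is *positive* ("$A$ is positive") if all eigenvalues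 of $G$ (equivalently, of $A$) are positive. **Corollary 2.3.** Suppose that $(U,A,B_1,\dots,B_{m/2})$ is admissible, that $A$ is positive, and that $m>n/2$. Let $f\in L^2(U)$ be positive, i.e. $f>0$ almost everywhere in $U$. Then the solution $u\in\mathcal D(A)$ of $$A(x,\partial/\partial x)u=f\ \text{ in } U,\qquad B_j(x,\partial/\partial x)u=0\ \text{ on } S,\quad j=1,\dots,\tfrac m2,$$ is positive somewhere in $U$: the set $\{x\in U: u(x)>0\}$ has positive Lebesgue measure. -/

import Mathlib

open MeasureTheory Filter Set
open scoped ENNReal Topology ContDiff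

noncomputable section

namespace EllipticBVP

/-- Euclidean `n`-space. -/
abbrev E (n : ℕ) : Type := EuclideanSpace ℝ (Fin n)

/-- The real Hilbert space `L²(U)`. -/
abbrev L2 {n : ℕ} (U : Set (E n)) : Type := Lp ℝ 2 (volume.restrict U)

/-- Surface measure on the boundary of `U`, namely the `(n-1)`-dimensional Hausdorff measure. -/
abbrev surfaceMeasure {n : ℕ} (U : Set (E n)) : Measure (E n) :=
  (Measure.hausdorffMeasure ((n : ℝ) - 1)).restrict (frontier U)

/-- The real Hilbert space `L²(∂U)`. -/
abbrev L2Boundary {n : ℕ} (U : Set (E n)) : Type := Lp ℝ 2 (surfaceMeasure U)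

/-! ### Multi-indices and classical derivatives -/

/-- The multi-indices `α` with `|α| ≤ k`. -/
def multiIdx (n k : ℕ) : Finset (Fin n → ℕ) :=
  (Fintype.piFinset fun _ => Finset.range (k + 1)).filter fun α => ∑ i, α i ≤ k

theorem mem_multiIdx {n k : ℕ} {α : Fin n → ℕ} : α ∈ multiIdx n k ↔ ∑ i, α i ≤ k := by
  simp only [multiIdx, Finset.mem_filter, Fintype.mem_piFinset, Finset.mem_range,
    and_iff_right_iff_imp]
  intro h i
  have := Finset.single_le_sum (f := α) (fun j _ => Nat.zero_le _) (Finset.mem_univ i)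
  omega

/-- The classical partial derivative `∂φ/∂xᵢ`. -/
def pderiv {n : ℕ} (i : Fin n) (φ : E n → ℝ) : E n → ℝ :=
  fun x => fderiv ℝ φ x (EuclideanSpace.single i 1)

/-- The classical derivative `D^α φ = ∂₁^{α₁} ⋯ ∂ₙ^{αₙ} φ`. -/
def mderiv {n : ℕ} (α : Fin n → ℕ) (φ : E n → ℝ) : E n → ℝ :=
  (List.finRange n).foldr (fun i g => (pderiv i)^[α i] g) φ

/-- A test function on `U`: smooth with compact support contained in `U`. -/
structure IsTestFun {n : ℕ} (U : Set (E n)) (φ : E n → ℝ) : Prop where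
  smooth : ContDiff ℝ ∞ φ
  compact : HasCompactSupport φ
  supp : tsupport φ ⊆ U

theorem contDiff_pderiv {n : ℕ} (i : Fin n) {φ : E n → ℝ} (h : ContDiff ℝ ∞ φ) :
    ContDiff ℝ ∞ (pderiv i φ) :=
  (h.fderiv_right (m := ∞) (by simp)).clm_apply contDiff_const

theorem hasCompactSupport_pderiv {n : ℕ} (i : Fin n) {φ : E n → ℝ} (h : HasCompactSupport φ) :
    HasCompactSupport (pderiv i φ) :=
  h.fderiv_apply (𝕜 := ℝ) _

theorem mderiv_induction {n : ℕ} {p : (E n → ℝ) → Prop}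
    (hp : ∀ i φ, p φ → p (pderiv i φ)) (α : Fin n → ℕ) {φ : E n → ℝ} (h : p φ) :
    p (mderiv α φ) := by
  unfold mderiv
  induction List.finRange n with
  | nil => simpa using h
  | cons i l ih =>
    simp only [List.foldr_cons]
    generalize α i = k
    induction k with
    | zero => simpa using ih
    | succ k ihk =>
      rw [Function.iterate_succ_apply']
      exact hp _ _ ihk

theorem contDiff_mderiv {n : ℕ} (α : Fin n → ℕ) {φ : E n → ℝ} (h : ContDiff ℝ ∞ φ) :
    ContDiff ℝ ∞ (mderiv α φ) :=
  mderiv_induction (p := fun φ => ContDiff ℝ ∞ φ) (fun i _ => contDiff_pderiv i) α h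

theorem hasCompactSupport_mderiv {n : ℕ} (α : Fin n → ℕ) {φ : E n → ℝ}
    (h : HasCompactSupport φ) : HasCompactSupport (mderiv α φ) :=
  mderiv_induction (p := fun φ => HasCompactSupport φ)
    (fun i _ => hasCompactSupport_pderiv i) α h

theorem mderiv_linear {n : ℕ} (α : Fin n → ℕ) {φ ψ : E n → ℝ} (c : ℝ) (hφ : ContDiff ℝ ∞ φ)
    (hψ : ContDiff ℝ ∞ ψ) :
    mderiv α (fun x => φ x + c * ψ x) = fun x => mderiv α φ x + c * mderiv α ψ x := by
  have key : ∀ (i : Fin n) (φ ψ : E n → ℝ), ContDiff ℝ ∞ φ → ContDiff ℝ ∞ ψ →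
      pderiv i (fun x => φ x + c * ψ x) = fun x => pderiv i φ x + c * pderiv i ψ x := by
    intro i φ ψ hφ hψ
    funext x
    have h1 : DifferentiableAt ℝ φ x := (hφ.differentiable (by simp)) x
    have h2 : DifferentiableAt ℝ ψ x := (hψ.differentiable (by simp)) x
    simp only [pderiv]
    rw [fderiv_fun_add h1 (h2.const_mul c), fderiv_const_mul h2]
    simp
  have main : ∀ l : List (Fin n),
      ContDiff ℝ ∞ (l.foldr (fun i g => (pderiv i)^[α i] g) φ) ∧
      ContDiff ℝ ∞ (l.foldr (fun i g => (pderiv i)^[α i] g) ψ) ∧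
      l.foldr (fun i g => (pderiv i)^[α i] g) (fun x => φ x + c * ψ x) = fun x =>
        l.foldr (fun i g => (pderiv i)^[α i] g) φ x +
          c * l.foldr (fun i g => (pderiv i)^[α i] g) ψ x := by
    intro l
    induction l with
    | nil => exact ⟨hφ, hψ, rfl⟩
    | cons i l ih =>
      simp only [List.foldr_cons]
      generalize α i = k
      induction k with
      | zero => exact ih
      | succ k ihk =>
        obtain ⟨a, b, e⟩ := ihk
        simp only [Function.iterate_succ_apply']
        refine ⟨contDiff_pderiv i a, contDiff_pderiv i b, ?_⟩
        rw [e]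
        exact key i _ _ a b
  exact (main _).2.2

/-! ### Weak derivatives and Sobolev spaces -/

/-- `v` is the weak derivative `D^α u` of `u` in `U`. -/
def IsWeakDeriv {n : ℕ} (U : Set (E n)) (α : Fin n → ℕ) (u v : L2 U) : Prop :=
  ∀ φ : E n → ℝ, IsTestFun U φ →
    ∫ x in U, u x * mderiv α φ x = (-1) ^ (∑ i, α i) * ∫ x in U, v x * φ x

theorem integrable_mul {n : ℕ} {U : Set (E n)} (u : L2 U) {φ : E n → ℝ} (h : ContDiff ℝ ∞ φ)
    (hc : HasCompactSupport φ) : Integrable (fun x => u x * φ x) (volume.restrict U) := by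
  have h2 : MemLp φ 2 (volume.restrict U) :=
    (h.continuous.memLp_of_hasCompactSupport hc).restrict U
  exact (Lp.memLp u).integrable_mul h2

theorem IsWeakDeriv.add_smul {n : ℕ} {U : Set (E n)} {α : Fin n → ℕ} {u v u' v' : L2 U}
    (h : IsWeakDeriv U α u v) (h' : IsWeakDeriv U α u' v') (c : ℝ) :
    IsWeakDeriv U α (u + c • u') (v + c • v') := by
  have aux : ∀ (a b : L2 U) (ψ : E n → ℝ), ContDiff ℝ ∞ ψ → HasCompactSupport ψ →
      ∫ x in U, (a + c • b : L2 U) x * ψ x = (∫ x in U, a x * ψ x) + c * ∫ x in U, b x * ψ x := by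
    intro a b ψ hψ hc
    rw [← integral_const_mul, ← integral_add (integrable_mul a hψ hc)
      ((integrable_mul b hψ hc).const_mul c)]
    refine integral_congr_ae ?_
    filter_upwards [Lp.coeFn_add a (c • b), Lp.coeFn_smul c b] with x h1 h2
    rw [h1, Pi.add_apply, h2, Pi.smul_apply, smul_eq_mul]
    ring
  intro φ hφ
  rw [aux _ _ _ (contDiff_mderiv α hφ.smooth) (hasCompactSupport_mderiv α hφ.compact),
    aux _ _ _ hφ.smooth hφ.compact, h φ hφ, h' φ hφ]
  ring

theorem IsWeakDeriv.unique {n : ℕ} {U : Set (E n)} (hU : IsOpen U) {α : Fin n → ℕ}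
    {u v v' : L2 U} (h : IsWeakDeriv U α u v) (h' : IsWeakDeriv U α u v') : v = v' := by
  have hint : ∀ w : L2 U, LocallyIntegrableOn (fun x => w x) U volume := fun w =>
    locallyIntegrableOn_of_locallyIntegrable_restrict ((Lp.memLp w).locallyIntegrable (by norm_num))
  have := hU.ae_eq_zero_of_integral_contDiff_smul_eq_zero ((hint v).sub (hint v')) (by
    intro g hg hc hs
    have hg' : IsTestFun U g := ⟨hg, hc, hs⟩
    have e := (h g hg').symm.trans (h' g hg')
    have e' : ∫ x in U, v x * g x = ∫ x in U, v' x * g x :=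
      mul_left_cancel₀ (pow_ne_zero _ (by norm_num)) e
    have hz : ∀ x, x ∉ U → g x • ((fun x => v x) - fun x => v' x) x = 0 := by
      intro x hx
      have : g x = 0 := image_eq_zero_of_notMem_tsupport fun hx' => hx (hs hx')
      simp [this]
    rw [← setIntegral_eq_integral_of_forall_compl_eq_zero hz]
    have : ∀ x, g x • ((fun x => v x) - fun x => v' x) x = v x * g x - v' x * g x := by
      intro x
      simp only [Pi.sub_apply, smul_eq_mul]
      ring
    simp only [this]
    rw [integral_sub (integrable_mul v hg hc) (integrable_mul v' hg hc), e', sub_self])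
  refine Lp.ext ?_
  rw [Filter.EventuallyEq, ae_restrict_iff' hU.measurableSet]
  filter_upwards [this] with x hx hxU
  exact sub_eq_zero.mp (hx hxU)

theorem isWeakDeriv_zero {n : ℕ} (U : Set (E n)) (α : Fin n → ℕ) : IsWeakDeriv U α 0 0 := by
  intro φ _
  have : ∀ ψ : E n → ℝ, ∫ x in U, (0 : L2 U) x * ψ x = 0 := by
    intro ψ
    rw [← integral_zero (E n) ℝ (μ := volume.restrict U)]
    refine integral_congr_ae ?_
    filter_upwards [Lp.coeFn_zero ℝ 2 (volume.restrict U)] with x hx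
    rw [hx, Pi.zero_apply, zero_mul]
  rw [this, this, mul_zero]

/-- The Sobolev space `H^m(U)`: all `u ∈ L²(U)` whose weak derivatives of order `≤ m` exist
in `L²(U)`. -/
def sobolev {n : ℕ} (U : Set (E n)) (m : ℕ) : Submodule ℝ (L2 U) where
  carrier := {u | ∀ α ∈ multiIdx n m, ∃ v, IsWeakDeriv U α u v}
  zero_mem' := fun α _ => ⟨0, isWeakDeriv_zero U α⟩
  add_mem' := by
    intro u u' hu hu' α hα
    obtain ⟨v, hv⟩ := hu α hα
    obtain ⟨v', hv'⟩ := hu' α hα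
    exact ⟨_, by simpa using hv.add_smul hv' 1⟩
  smul_mem' := by
    intro c u hu α hα
    obtain ⟨v, hv⟩ := hu α hα
    exact ⟨_, by simpa using (isWeakDeriv_zero U α).add_smul hv c⟩

open Classical in
/-- The weak derivative `D^α u ∈ L²(U)`, where it exists. (It is unique, since `U` is open
wherever this is used.) -/
def weakDeriv {n : ℕ} (U : Set (E n)) (α : Fin n → ℕ) (u : L2 U) : L2 U :=
  if h : ∃ v, IsWeakDeriv U α u v then h.choose else 0

theorem weakDeriv_spec {n : ℕ} {U : Set (E n)} {m : ℕ} {u : L2 U} (hu : u ∈ sobolev U m)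
    {α : Fin n → ℕ} (hα : α ∈ multiIdx n m) : IsWeakDeriv U α u (weakDeriv U α u) := by
  have h := hu α hα
  rw [weakDeriv, dif_pos h]
  exact h.choose_spec

theorem weakDeriv_add_smul {n : ℕ} {U : Set (E n)} (hU : IsOpen U) {m : ℕ} {u u' : L2 U}
    (hu : u ∈ sobolev U m) (hu' : u' ∈ sobolev U m) (c : ℝ) {α : Fin n → ℕ}
    (hα : α ∈ multiIdx n m) :
    weakDeriv U α (u + c • u') = weakDeriv U α u + c • weakDeriv U α u' :=
  (weakDeriv_spec ((sobolev U m).add_mem hu ((sobolev U m).smul_mem c hu')) hα).unique hU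
    ((weakDeriv_spec hu hα).add_smul (weakDeriv_spec hu' hα) c)

theorem weakDeriv_zero {n : ℕ} {U : Set (E n)} (hU : IsOpen U) (α : Fin n → ℕ) :
    weakDeriv U α 0 = 0 :=
  (weakDeriv_spec (m := ∑ i, α i) (Submodule.zero_mem _) (mem_multiIdx.2 le_rfl)).unique hU
    (isWeakDeriv_zero U α)

/-! ### Boundary traces -/

/-- `g ∈ L²(∂U)` is the trace on `∂U` of `v ∈ H¹(U)`. The trace operator is the continuous
extension to `H¹(U)` of the restriction `φ ↦ φ|∂U` of functions smooth up to the boundary, so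
this says that some sequence of smooth functions converges to `v` in `H¹(U)` while its boundary
values converge to `g` in `L²(∂U)`. -/
def IsTrace {n : ℕ} (U : Set (E n)) (v : L2 U) (g : L2Boundary U) : Prop :=
  v ∈ sobolev U 1 ∧ ∃ φ : ℕ → E n → ℝ, (∀ k, ContDiff ℝ ∞ (φ k)) ∧
    (∀ α ∈ multiIdx n 1, Tendsto
      (fun k => eLpNorm (fun x => mderiv α (φ k) x - weakDeriv U α v x) 2 (volume.restrict U))
      atTop (𝓝 0)) ∧
    Tendsto (fun k => eLpNorm (fun x => φ k x - g x) 2 (surfaceMeasure U)) atTop (𝓝 0)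

theorem tendsto_eLpNorm_add_smul {n : ℕ} {μ : Measure (E n)} {a b : ℕ → E n → ℝ} {p q r : Lp ℝ 2 μ}
    (c : ℝ) (ha' : ∀ k, Continuous (a k)) (hb' : ∀ k, Continuous (b k))
    (hr : r = p + c • q)
    (ha : Tendsto (fun k => eLpNorm (fun x => a k x - p x) 2 μ) atTop (𝓝 0))
    (hb : Tendsto (fun k => eLpNorm (fun x => b k x - q x) 2 μ) atTop (𝓝 0)) :
    Tendsto (fun k => eLpNorm (fun x => (a k x + c * b k x) - r x) 2 μ) atTop (𝓝 0) := by
  have hlim : Tendsto (fun k => eLpNorm (fun x => a k x - p x) 2 μ +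
      ‖c‖ₑ * eLpNorm (fun x => b k x - q x) 2 μ) atTop (𝓝 0) := by
    simpa using ha.add (ENNReal.Tendsto.const_mul hb (Or.inr (by simp)))
  refine tendsto_of_tendsto_of_tendsto_of_le_of_le tendsto_const_nhds hlim
    (fun _ => zero_le) fun k => ?_
  have h1 : AEStronglyMeasurable (fun x => a k x - p x) μ :=
    (ha' k).aestronglyMeasurable.sub (Lp.aestronglyMeasurable p)
  have h2 : AEStronglyMeasurable (fun x => b k x - q x) μ :=
    (hb' k).aestronglyMeasurable.sub (Lp.aestronglyMeasurable q)
  have e : (fun x => (a k x + c * b k x) - r x) =ᵐ[μ]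
      (fun x => a k x - p x) + c • (fun x => b k x - q x) := by
    subst hr
    filter_upwards [Lp.coeFn_add p (c • q), Lp.coeFn_smul c q] with x h3 h4
    rw [h3, Pi.add_apply, h4]
    simp only [Pi.add_apply, Pi.smul_apply, smul_eq_mul]
    ring
  simp only
  rw [eLpNorm_congr_ae e, ← eLpNorm_const_smul]
  exact eLpNorm_add_le h1 (h2.const_smul c) (by norm_num)

theorem IsTrace.add_smul {n : ℕ} {U : Set (E n)} (hU : IsOpen U) {v v' : L2 U}
    {g g' : L2Boundary U} (h : IsTrace U v g) (h' : IsTrace U v' g') (c : ℝ) :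
    IsTrace U (v + c • v') (g + c • g') := by
  obtain ⟨hv, φ, hφ, h1, h2⟩ := h
  obtain ⟨hv', φ', hφ', h1', h2'⟩ := h'
  refine ⟨(sobolev U 1).add_mem hv ((sobolev U 1).smul_mem c hv'),
    fun k x => φ k x + c * φ' k x, fun k => (hφ k).add (contDiff_const.mul (hφ' k)), ?_, ?_⟩
  · intro α hα
    have := tendsto_eLpNorm_add_smul c (fun k => (contDiff_mderiv α (hφ k)).continuous)
      (fun k => (contDiff_mderiv α (hφ' k)).continuous) (weakDeriv_add_smul hU hv hv' c hα)
      (h1 α hα) (h1' α hα)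
    refine this.congr fun k => ?_
    rw [mderiv_linear α c (hφ k) (hφ' k)]
  · exact tendsto_eLpNorm_add_smul c (fun k => (hφ k).continuous) (fun k => (hφ' k).continuous) rfl
      h2 h2'

theorem isTrace_zero {n : ℕ} {U : Set (E n)} (hU : IsOpen U) :
    IsTrace U (0 : L2 U) (0 : L2Boundary U) := by
  have hz : ∀ α : Fin n → ℕ, mderiv α (fun _ => (0 : ℝ)) = fun _ => 0 := fun α =>
    mderiv_induction (p := fun φ : E n → ℝ => φ = fun _ => 0)
      (by rintro i _ rfl; funext x; simp [pderiv]) α rfl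
  refine ⟨Submodule.zero_mem _, fun _ _ => 0, fun _ => contDiff_const, ?_, ?_⟩
  · intro α _
    have : eLpNorm (fun x => mderiv α (fun _ => (0 : ℝ)) x - weakDeriv U α 0 x) 2
        (volume.restrict U) = 0 := by
      rw [hz, weakDeriv_zero hU, ← eLpNorm_zero (p := 2) (μ := volume.restrict U) (ε := ℝ)]
      refine eLpNorm_congr_ae ?_
      filter_upwards [Lp.coeFn_zero ℝ 2 (volume.restrict U)] with x hx
      simp only [hx, Pi.zero_apply, sub_zero]
    simp only [this, tendsto_const_nhds]
  · have : eLpNorm (fun x => (0 : ℝ) - (0 : L2Boundary U) x) 2 (surfaceMeasure U) = 0 := by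
      rw [← eLpNorm_zero (p := 2) (μ := surfaceMeasure U) (ε := ℝ)]
      refine eLpNorm_congr_ae ?_
      filter_upwards [Lp.coeFn_zero ℝ 2 (surfaceMeasure U)] with x hx
      simp only [hx, Pi.zero_apply, sub_zero]
    simp only [this, tendsto_const_nhds]

/-! ### Smooth boundaries and differential operators -/

/-- `ρ` is a smooth defining function of `U` near the boundary point `x`. Near `x` the boundary of
`U` is then the smooth hypersurface `ρ = 0`, with `U` on one side, and `∇ρ(x)` is an (outward)
normal vector at `x`. -/
structure IsDefiningFun {n : ℕ} (U : Set (E n)) (x : E n) (ρ : E n → ℝ) : Prop where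
  smooth : ContDiff ℝ ∞ ρ
  eq_zero : ρ x = 0
  gradient_ne : gradient ρ x ≠ 0
  local_eq : ∀ᶠ y in 𝓝 x, (y ∈ U ↔ ρ y < 0)

/-- The boundary of `U` is a smooth hypersurface. For bounded `U` it is compact, so it has finitely
many connected components, each of which is a smooth closed hypersurface. -/
def HasSmoothBoundary {n : ℕ} (U : Set (E n)) : Prop :=
  ∀ x ∈ frontier U, ∃ ρ, IsDefiningFun U x ρ

/-- A linear differential operator `∑_{|α| ≤ k} a_α(x) D^α` of order at most `k` with real
coefficients that are continuous on `K`. -/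
structure DiffOp (n : ℕ) (K : Set (E n)) (k : ℕ) where
  coeff : (Fin n → ℕ) → E n → ℝ
  continuousOn : ∀ α, ContinuousOn (coeff α) K

/-- The principal symbol `∑_{|α| = k} a_α(x) ξ^α`. -/
def DiffOp.principalSymbol {n k : ℕ} {K : Set (E n)} (T : DiffOp n K k) (x ξ : E n) : ℝ :=
  ∑ α ∈ (multiIdx n k).filter (fun α => ∑ i, α i = k), T.coeff α x * ∏ i, ξ i ^ α i

/-- `T` is elliptic of order `k` on `K`. -/
def DiffOp.IsElliptic {n k : ℕ} {K : Set (E n)} (T : DiffOp n K k) : Prop :=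
  ∀ x ∈ K, ∀ ξ : E n, ξ ≠ 0 → T.principalSymbol x ξ ≠ 0

/-- A collection `(U, A, B₁, …, B_{m/2})`: a bounded domain with smooth boundary, an elliptic
operator of order `m`, and boundary operators of distinct orders less than `m` for which the
normal direction is nowhere characteristic. -/
structure BoundaryValueProblem (n m : ℕ) where
  n_pos : 0 < n
  m_pos : 0 < m
  m_even : Even m
  U : Set (E n)
  isOpen : IsOpen U
  isConnected : IsConnected U
  isBounded : Bornology.IsBounded U
  smoothBoundary : HasSmoothBoundary U
  A : DiffOp n (closure U) m
  elliptic : A.IsElliptic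
  ord : Fin (m / 2) → ℕ
  ord_lt : ∀ j, ord j < m
  ord_injective : Function.Injective ord
  B : ∀ j, DiffOp n (frontier U) (ord j)
  noncharacteristic : ∀ j, ∀ x ∈ frontier U, ∀ ρ, IsDefiningFun U x ρ →
    (B j).principalSymbol x (gradient ρ x) ≠ 0

namespace BoundaryValueProblem

variable {n m : ℕ} (P : BoundaryValueProblem n m)

/-- The boundary condition `B_j(x, ∂/∂x) u = 0` on `∂U`, in the sense of traces of the weak
derivatives of `u`. -/
def BoundaryCondition (j : Fin (m / 2)) (u : L2 P.U) : Prop :=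
  ∃ g : (Fin n → ℕ) → L2Boundary P.U,
    (∀ β ∈ multiIdx n (P.ord j), IsTrace P.U (weakDeriv P.U β u) (g β)) ∧
    ∀ᵐ x ∂(surfaceMeasure P.U), ∑ β ∈ multiIdx n (P.ord j), (P.B j).coeff β x * g β x = 0

theorem multiIdx_ord {j : Fin (m / 2)} {β : Fin n → ℕ} (h : β ∈ multiIdx n (P.ord j)) :
    β ∈ multiIdx n m :=
  mem_multiIdx.2 ((mem_multiIdx.1 h).trans (P.ord_lt j).le)

theorem boundaryCondition_zero (j : Fin (m / 2)) : P.BoundaryCondition j 0 := by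
  refine ⟨fun _ => 0, fun β _ => ?_, ?_⟩
  · rw [weakDeriv_zero P.isOpen]
    exact isTrace_zero P.isOpen
  · filter_upwards [Lp.coeFn_zero ℝ 2 (surfaceMeasure P.U)] with x hx
    simp only [hx, Pi.zero_apply, mul_zero, Finset.sum_const_zero]

theorem boundaryCondition_add_smul {j : Fin (m / 2)} {u u' : L2 P.U} (hu : u ∈ sobolev P.U m)
    (hu' : u' ∈ sobolev P.U m) (h : P.BoundaryCondition j u) (h' : P.BoundaryCondition j u')
    (c : ℝ) : P.BoundaryCondition j (u + c • u') := by
  obtain ⟨g, hg, e⟩ := h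
  obtain ⟨g', hg', e'⟩ := h'
  refine ⟨fun β => g β + c • g' β, fun β hβ => ?_, ?_⟩
  · rw [weakDeriv_add_smul P.isOpen hu hu' c (P.multiIdx_ord hβ)]
    exact (hg β hβ).add_smul P.isOpen (hg' β hβ) c
  · have h1 : ∀ᵐ x ∂(surfaceMeasure P.U), ∀ β, (g β + c • g' β : L2Boundary P.U) x =
        g β x + c * g' β x := by
      refine ae_all_iff.2 fun β => ?_
      filter_upwards [Lp.coeFn_add (g β) (c • g' β), Lp.coeFn_smul c (g' β)] with x h3 h4
      rw [h3, Pi.add_apply, h4, Pi.smul_apply, smul_eq_mul]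
    filter_upwards [h1, e, e'] with x hx ex ex'
    simp only [hx, mul_add, Finset.sum_add_distrib, ex, zero_add]
    rw [← mul_zero c, ← ex', Finset.mul_sum]
    exact Finset.sum_congr rfl fun β _ => by ring

/-- The domain `D(A)`: all `u ∈ H^m(U)` with `B_j u = 0` on `∂U` for `j = 1, …, m/2`. -/
def domain : Submodule ℝ (L2 P.U) where
  carrier := {u | u ∈ sobolev P.U m ∧ ∀ j, P.BoundaryCondition j u}
  zero_mem' := ⟨Submodule.zero_mem _, P.boundaryCondition_zero⟩
  add_mem' := by
    rintro u u' ⟨hu, h⟩ ⟨hu', h'⟩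
    refine ⟨(sobolev P.U m).add_mem hu hu', fun j => ?_⟩
    simpa using P.boundaryCondition_add_smul hu hu' (h j) (h' j) 1
  smul_mem' := by
    rintro c u ⟨hu, h⟩
    refine ⟨(sobolev P.U m).smul_mem c hu, fun j => ?_⟩
    simpa using P.boundaryCondition_add_smul (Submodule.zero_mem _) hu
      (P.boundaryCondition_zero j) (h j) c

theorem memLp_coeff_mul (α : Fin n → ℕ) (v : L2 P.U) :
    MemLp (fun x => P.A.coeff α x * v x) 2 (volume.restrict P.U) := by
  have hK : IsCompact (closure P.U) := P.isBounded.isCompact_closure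
  obtain ⟨C, hC⟩ := hK.exists_bound_of_continuousOn (P.A.continuousOn α)
  have hm : AEStronglyMeasurable (P.A.coeff α) (volume.restrict P.U) :=
    ((P.A.continuousOn α).mono subset_closure).aestronglyMeasurable P.isOpen.measurableSet
  have hb : MemLp (P.A.coeff α) ⊤ (volume.restrict P.U) := by
    refine memLp_top_of_bound hm C ?_
    filter_upwards [ae_restrict_mem P.isOpen.measurableSet] with x hx
    exact hC x (subset_closure hx)
  exact (Lp.memLp v).mul' hb

theorem memLp_op (u : L2 P.U) :
    MemLp (fun x => ∑ α ∈ multiIdx n m, P.A.coeff α x * weakDeriv P.U α u x) 2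
      (volume.restrict P.U) :=
  memLp_finsetSum _ fun α _ => P.memLp_coeff_mul α _

theorem op_aux {u u' : L2 P.U} (hu : u ∈ sobolev P.U m) (hu' : u' ∈ sobolev P.U m) (c : ℝ) :
    (P.memLp_op (u + c • u')).toLp _ = (P.memLp_op u).toLp _ + c • (P.memLp_op u').toLp _ := by
  rw [← MemLp.toLp_const_smul, ← MemLp.toLp_add, MemLp.toLp_eq_toLp_iff]
  have h1 : ∀ᵐ x ∂(volume.restrict P.U), ∀ α,
      (weakDeriv P.U α u + c • weakDeriv P.U α u' : L2 P.U) x =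
        weakDeriv P.U α u x + c * weakDeriv P.U α u' x := by
    refine ae_all_iff.2 fun α => ?_
    filter_upwards [Lp.coeFn_add (weakDeriv P.U α u) (c • weakDeriv P.U α u'),
      Lp.coeFn_smul c (weakDeriv P.U α u')] with x h3 h4
    rw [h3, Pi.add_apply, h4, Pi.smul_apply, smul_eq_mul]
  filter_upwards [h1] with x hx
  simp only [Pi.add_apply, Pi.smul_apply, smul_eq_mul, Finset.mul_sum]
  rw [← Finset.sum_add_distrib]
  refine Finset.sum_congr rfl fun α hα => ?_
  rw [weakDeriv_add_smul P.isOpen hu hu' c hα, hx]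
  ring

/-- The operator `A : D(A) → L²(U)`, `(A u)(x) = ∑_{|α| ≤ m} a_α(x) D^α u(x)`. -/
def op : P.domain →ₗ[ℝ] L2 P.U where
  toFun u := (P.memLp_op u).toLp _
  map_add' u v := by
    have := P.op_aux u.2.1 v.2.1 1
    rw [one_smul, one_smul] at this
    exact this
  map_smul' c u := by
    have := P.op_aux (Submodule.zero_mem _) u.2.1 c
    have h0 := P.op_aux (Submodule.zero_mem _) (Submodule.zero_mem _) 1
    simp only [one_smul, add_zero, left_eq_add] at h0
    rw [h0, zero_add] at this
    simp only [zero_add] at this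
    exact this

/-- The Green's operator `G = A⁻¹`, as an operator on `L²(U)`. -/
def green (h : Function.Bijective P.op) : L2 P.U →ₗ[ℝ] L2 P.U :=
  P.domain.subtype ∘ₗ (LinearEquiv.ofBijective P.op h).symm.toLinearMap

/-- `(U, A, B₁, …, B_{m/2})` is admissible: `A` is one-to-one from `D(A)` onto `L²(U)`, and
`A⁻¹` is self-adjoint in `L²(U)`. (`A⁻¹` is defined on all of `L²(U)`, so self-adjoint means
symmetric.) -/
structure IsAdmissible : Prop where
  bijective : Function.Bijective P.op
  selfAdjoint : (P.green bijective).IsSymmetric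

/-- Positivity: all eigenvalues of the Green's operator are positive. (They are real, since the
Green's operator is self-adjoint; they are the reciprocals of the eigenvalues of `A`.) -/
def IsPositive (h : P.IsAdmissible) : Prop :=
  ∀ μ : ℝ, Module.End.HasEigenvalue (P.green h.bijective) μ → 0 < μ

end BoundaryValueProblem

end EllipticBVP

end

/-! Everything rests on the strict inequality `⟪G f, f⟫ > 0` for `f ≠ 0`. With `u = G f` it reads `∫
u f > 0`, which is impossible if `f > 0` and `u ≤ 0` almost everywhere.

The positivity hypothesis concerns only eigenvalues, so it must be converted into a statement about
the quadratic form. For a compact self-adjoint operator the eigenvectors span a dense subspace, so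
nonnegative eigenvalues give a nonnegative form (`inner_nonneg_of_eigenvalues`); injectivity and a
discriminant argument make it strictly positive (`inner_pos_of_eigenvalues`).

The main work is the compactness of `G`. Being symmetric and defined everywhere, `G` is bounded
(Hellinger–Toeplitz), and the closed graph theorem bounds each `D^α G` with `|α| ≤ m` on `L²(U)`.
Rellich's theorem is used in quantitative form: up to finitely many functionals, `‖v‖²` is at most
`ε ‖∇v‖²`. It is proved for smooth functions by comparing `φ` with averages over small balls
displaced into `U` along a cone. The smooth boundary supplies such cones locally, compactness of the
closure patches the estimates together, and the approximating sequences in the definition of trace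
carry them over to the domain of `A`. -/

noncomputable section

namespace EllipticBVP

/-! ### Compact self-adjoint operators -/

section Hilbert

open scoped InnerProductSpace

variable {H : Type*} [NormedAddCommGroup H] [InnerProductSpace ℝ H]

/-- A bounded operator that is arbitrarily small on closed subspaces of finite codimension is
compact. -/
theorem isCompactOperator_of_finite_functionals {H' : Type*} [NormedAddCommGroup H']
    [InnerProductSpace ℝ H'] [CompleteSpace H'] (T : H →L[ℝ] H')
    (h : ∀ ε > 0, ∃ (ι : Type) (_ : Fintype ι) (c : ι → H),
      ∀ x, (∀ i, ⟪c i, x⟫_ℝ = 0) → ‖T x‖ ≤ ε * ‖x‖) : IsCompactOperator T := by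
  choose! ι hι c hc using h
  let V : ℕ → Submodule ℝ H := fun k => Submodule.span ℝ (range (c (1 / ((k : ℝ) + 1))))
  have hpos : ∀ k : ℕ, (0 : ℝ) < 1 / ((k : ℝ) + 1) := fun k => by positivity
  have hfin : ∀ k, FiniteDimensional ℝ (V k) := fun k => by
    have := hι _ (hpos k)
    exact FiniteDimensional.span_of_finite ℝ (finite_range _)
  -- With `P` the projection onto `V k`, the difference `T - T P` sees only the component orthogonal
  -- to `V k`, where `T` is bounded by `1 / (k + 1)`. So `T` is a norm limit of finite-rank
  -- operators.
  refine isCompactOperator_of_tendsto (l := atTop)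
    (F := fun k => T ∘L (V k).starProjection) ?_ (Eventually.of_forall fun k => ?_)
  · rw [tendsto_iff_norm_sub_tendsto_zero]
    refine squeeze_zero (fun _ => norm_nonneg _) (fun k => ?_)
      tendsto_one_div_add_atTop_nhds_zero_nat
    refine ContinuousLinearMap.opNorm_le_bound _ (hpos k).le fun x => ?_
    have hx : x - (V k).starProjection x ∈ (V k)ᗮ := Submodule.sub_starProjection_mem_orthogonal x
    have h1 := hc _ (hpos k) (x - (V k).starProjection x) fun i =>
      (Submodule.mem_orthogonal _ _).1 hx _ (Submodule.subset_span (mem_range_self i))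
    have h2 : ‖x - (V k).starProjection x‖ ≤ ‖x‖ := by
      have := Submodule.norm_starProjection_apply_le (V k)ᗮ x
      rwa [Submodule.starProjection_orthogonal_val] at this
    calc ‖(T ∘L (V k).starProjection - T) x‖ = ‖T (x - (V k).starProjection x)‖ := by
          rw [← norm_neg]; simp
      _ ≤ _ := h1.trans (mul_le_mul_of_nonneg_left h2 (hpos k).le)
  · have : ProperSpace (V k) := FiniteDimensional.proper_real _
    exact (isCompactOperator_of_locallyCompactSpace_rng
      (T ∘L (V k).subtypeL)).comp_clm (V k).orthogonalProjectionOnto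

variable [CompleteSpace H]

/-- A compact self-adjoint operator without negative eigenvalues is positive semidefinite. -/
theorem inner_nonneg_of_eigenvalues {T : H →L[ℝ] H} (hT : IsCompactOperator T)
    (hS : (T : H →ₗ[ℝ] H).IsSymmetric)
    (hpos : ∀ μ : ℝ, Module.End.HasEigenvalue (T : H →ₗ[ℝ] H) μ → 0 ≤ μ) (x : H) :
    0 ≤ ⟪T x, x⟫_ℝ := by
  set S : Submodule ℝ H := ⨆ μ : ℝ, Module.End.eigenspace (T : H →ₗ[ℝ] H) μ with hSdef
  have hdense : Dense (S : Set H) := by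
    rw [dense_iff_closure_eq, ← Submodule.topologicalClosure_coe,
      Submodule.topologicalClosure_eq_top_iff.2
        (ContinuousLinearMap.orthogonalComplement_iSup_eigenspaces_eq_bot hT hS)]
    rfl
  have hcl : IsClosed {y : H | 0 ≤ ⟪T y, y⟫_ℝ} :=
    isClosed_le continuous_const (T.continuous.inner continuous_id)
  -- Nonnegativity is a closed condition, so finite sums of eigenvectors suffice. In the expanded
  -- double sum every term is nonnegative: off-diagonal ones vanish by orthogonality of eigenspaces.
  refine hcl.closure_subset_iff.2 (fun y hy => ?_) (hdense x)
  obtain ⟨f, hf, rfl⟩ := (Submodule.mem_iSup_iff_exists_finsupp _ _).1 hy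
  have hTf : ∀ μ, T (f μ) = μ • f μ := fun μ => Module.End.mem_eigenspace_iff.1 (hf μ)
  simp only [mem_ofPred_eq, Finsupp.sum, map_sum, sum_inner, inner_sum]
  refine Finset.sum_nonneg fun μ _ => Finset.sum_nonneg fun ν _ => ?_
  rw [hTf, inner_smul_left]
  by_cases hμν : μ = ν
  · subst hμν
    by_cases h0 : f μ = 0
    · simp [h0]
    · exact mul_nonneg (hpos μ (Module.End.hasEigenvalue_of_hasEigenvector ⟨hf μ, h0⟩))
        real_inner_self_nonneg
  · have : ⟪f ν, f μ⟫_ℝ = 0 :=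
      hS.orthogonalFamily_eigenspaces.pairwise hμν (hf μ) (f ν) (hf ν)
    simp [this]

/-- An injective compact self-adjoint operator without negative eigenvalues is positive definite. -/
theorem inner_pos_of_eigenvalues {T : H →L[ℝ] H} (hT : IsCompactOperator T)
    (hS : (T : H →ₗ[ℝ] H).IsSymmetric) (hinj : Function.Injective T)
    (hpos : ∀ μ : ℝ, Module.End.HasEigenvalue (T : H →ₗ[ℝ] H) μ → 0 ≤ μ) {x : H} (hx : x ≠ 0) :
    0 < ⟪T x, x⟫_ℝ := by
  have hnn := inner_nonneg_of_eigenvalues hT hS hpos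
  refine lt_of_le_of_ne (hnn x) fun h0 => hx (hinj ?_)
  rw [map_zero, ← inner_self_eq_zero (𝕜 := ℝ)]
  -- The form evaluated at `x + t • T x`. Its constant term is `⟪T x, x⟫ = 0`, so nonnegativity for
  -- all `t` forces the linear coefficient `2 ‖T x‖²` to vanish.
  have key : ∀ t : ℝ, 0 ≤ ⟪T (T x), T x⟫_ℝ * (t * t) + 2 * ⟪T x, T x⟫_ℝ * t + 0 := fun t => by
    have e : ⟪T (x + t • T x), x + t • T x⟫_ℝ =
        ⟪T (T x), T x⟫_ℝ * (t * t) + 2 * ⟪T x, T x⟫_ℝ * t + 0 := by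
      have hs : ⟪T (T x), x⟫_ℝ = ⟪T x, T x⟫_ℝ := hS (T x) x
      simp only [map_add, map_smul, inner_add_left, inner_add_right, real_inner_smul_left,
        real_inner_smul_right, ← h0, hs]
      ring
    exact e ▸ hnn _
  have := discrim_le_zero key
  rw [discrim] at this
  have h2 : (2 * ⟪T x, T x⟫_ℝ) ^ 2 = 0 := le_antisymm (by linarith) (sq_nonneg _)
  simpa using h2

end Hilbert

/-! ### Integral inequalities -/

/-- Cauchy–Schwarz against the constant function 1. -/
theorem lintegral_sq_le {α : Type*} [MeasurableSpace α] (μ : Measure α) {f : α → ℝ≥0∞}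
    (hf : AEMeasurable f μ) : (∫⁻ x, f x ∂μ) ^ 2 ≤ μ univ * ∫⁻ x, f x ^ 2 ∂μ := by
  have h := ENNReal.lintegral_mul_le_Lp_mul_Lq μ Real.HolderConjugate.two_two
    (aemeasurable_const (b := (1 : ℝ≥0∞))) hf
  simp only [Pi.mul_apply, one_mul, ENNReal.one_rpow, lintegral_const] at h
  have h2 : ∀ a : ℝ≥0∞, (a ^ (1 / (2 : ℝ))) ^ 2 = a := fun a => by
    rw [← ENNReal.rpow_natCast, ← ENNReal.rpow_mul]; norm_num
  calc (∫⁻ x, f x ∂μ) ^ 2 ≤ _ := pow_le_pow_left' h 2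
    _ = _ := by rw [mul_pow, h2, h2]; simp

variable {n : ℕ}

/-- The fundamental theorem of calculus along the segment from `x` to `x + z`, followed by
Cauchy–Schwarz on the unit interval. -/
theorem enorm_sub_sq_le {φ : E n → ℝ} (hφ : ContDiff ℝ 1 φ) (x z : E n) :
    ‖φ x - φ (x + z)‖ₑ ^ 2 ≤
      ‖z‖ₑ ^ 2 * ∫⁻ s in Icc (0 : ℝ) 1, ‖fderiv ℝ φ (x + s • z)‖ₑ ^ 2 := by
  have hc : Continuous fun s : ℝ => fderiv ℝ φ (x + s • z) :=
    (hφ.continuous_fderiv (by simp)).comp (by fun_prop)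
  have hd : ∀ s : ℝ, HasDerivAt (fun s : ℝ => φ (x + s • z)) (fderiv ℝ φ (x + s • z) z) s := by
    intro s
    have h1 : HasDerivAt (fun s : ℝ => x + s • z) z s := by
      simpa using ((hasDerivAt_id s).smul_const z).const_add x
    exact ((hφ.differentiable (by simp)) _).hasFDerivAt.comp_hasDerivAt s h1
  have hftc := intervalIntegral.integral_eq_sub_of_hasDerivAt (a := 0) (b := 1)
    (fun s _ => hd s) ((hc.clm_apply continuous_const).intervalIntegrable _ _)
  rw [zero_smul, one_smul, add_zero, intervalIntegral.integral_of_le zero_le_one,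
    ← integral_Icc_eq_integral_Ioc] at hftc
  have h1 : ‖φ x - φ (x + z)‖ₑ ≤ ‖z‖ₑ * ∫⁻ s in Icc (0 : ℝ) 1, ‖fderiv ℝ φ (x + s • z)‖ₑ := by
    rw [← enorm_neg, neg_sub, ← hftc]
    refine (enorm_integral_le_lintegral_enorm _).trans ?_
    rw [← lintegral_const_mul _ hc.enorm.measurable]
    refine lintegral_mono fun s => ?_
    rw [mul_comm]
    exact ContinuousLinearMap.le_opENorm _ _
  refine (pow_le_pow_left' h1 2).trans ?_
  rw [mul_pow]
  gcongr
  refine (lintegral_sq_le _ hc.enorm.measurable.aemeasurable).trans (le_of_eq ?_)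
  simp

/-- `L²` estimate for the difference of a function and its translate. -/
theorem lintegral_translate_sub_le {U S : Set (E n)} {φ : E n → ℝ} (hφ : ContDiff ℝ 1 φ) (z : E n)
    (h : ∀ x ∈ S, ∀ s ∈ Icc (0 : ℝ) 1, x + s • z ∈ U) :
    ∫⁻ x in S, ‖φ x - φ (x + z)‖ₑ ^ 2 ≤ ‖z‖ₑ ^ 2 * ∫⁻ x in U, ‖fderiv ℝ φ x‖ₑ ^ 2 := by
  have hc : Continuous (fderiv ℝ φ) := hφ.continuous_fderiv (by simp)
  have hm : Measurable fun p : E n × ℝ => ‖fderiv ℝ φ (p.1 + p.2 • z)‖ₑ ^ 2 :=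
    ((hc.comp (by fun_prop : Continuous fun p : E n × ℝ => p.1 + p.2 • z)).enorm.measurable).pow_const
      2
  calc ∫⁻ x in S, ‖φ x - φ (x + z)‖ₑ ^ 2
      ≤ ∫⁻ x in S, ‖z‖ₑ ^ 2 * ∫⁻ s in Icc (0 : ℝ) 1, ‖fderiv ℝ φ (x + s • z)‖ₑ ^ 2 :=
        lintegral_mono fun x => enorm_sub_sq_le hφ x z
    _ = ‖z‖ₑ ^ 2 * ∫⁻ x in S, ∫⁻ s in Icc (0 : ℝ) 1, ‖fderiv ℝ φ (x + s • z)‖ₑ ^ 2 :=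
        lintegral_const_mul' _ _ (by simp)
    _ = ‖z‖ₑ ^ 2 * ∫⁻ s in Icc (0 : ℝ) 1, ∫⁻ x in S, ‖fderiv ℝ φ (x + s • z)‖ₑ ^ 2 := by
        rw [lintegral_lintegral_swap hm.aemeasurable]
    _ ≤ ‖z‖ₑ ^ 2 * ∫⁻ s in Icc (0 : ℝ) 1, ∫⁻ x in U, ‖fderiv ℝ φ x‖ₑ ^ 2 := by
        gcongr ‖z‖ₑ ^ 2 * ?_
        -- For fixed `s`, translation by `s • z` preserves volume and carries `S` into `U`, so the
        -- bound is uniform in `s`.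
        refine setLIntegral_mono' (measurableSet_Icc (a := (0 : ℝ)) (b := 1)) fun s hs => ?_
        have hpre : S ⊆ (fun x => x + s • z) ⁻¹' U := fun x hx => h x hx s hs
        refine (lintegral_mono_set hpre).trans (le_of_eq ?_)
        exact (measurePreserving_add_right volume (s • z)).setLIntegral_comp_preimage_emb
          (measurableEmbedding_addRight _) (fun y => ‖fderiv ℝ φ y‖ₑ ^ 2) U
    _ = _ := by simp

/-- The deviation of `φ x` from the mean of `φ` over a bounded set. -/
theorem enorm_sub_average_sq_le {φ : E n → ℝ} (hφ : Continuous φ) (a : ℝ) {B : Set (E n)}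
    (hB : Bornology.IsBounded B) (h0 : volume B ≠ 0) :
    ‖a - (volume.real B)⁻¹ * ∫ y in B, φ y‖ₑ ^ 2 ≤
      (volume B)⁻¹ * ∫⁻ y in B, ‖a - φ y‖ₑ ^ 2 := by
  have htop : volume B ≠ ⊤ := hB.measure_lt_top.ne
  have hreal : volume.real B ≠ 0 := by
    simp [Measure.real, ENNReal.toReal_eq_zero_iff, h0, htop]
  have hint : IntegrableOn φ B :=
    (hφ.continuousOn.integrableOn_compact hB.isCompact_closure).mono_set subset_closure
  have e : a - (volume.real B)⁻¹ * ∫ y in B, φ y = (volume.real B)⁻¹ * ∫ y in B, (a - φ y) := by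
    have : Integrable (fun _ : E n => a) (volume.restrict B) := by
      have : IsFiniteMeasure (volume.restrict B) := ⟨by simpa using hB.measure_lt_top⟩
      exact integrable_const a
    rw [integral_sub this hint, setIntegral_const, smul_eq_mul]
    field_simp
  have hV : ‖(volume.real B)⁻¹‖ₑ = (volume B)⁻¹ := by
    rw [enorm_inv hreal, Real.enorm_eq_ofReal measureReal_nonneg, Measure.real,
      ENNReal.ofReal_toReal htop]
  rw [e, enorm_mul, hV, mul_pow]
  have h1 : ‖∫ y in B, (a - φ y)‖ₑ ^ 2 ≤ volume B * ∫⁻ y in B, ‖a - φ y‖ₑ ^ 2 := by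
    refine (pow_le_pow_left' (enorm_integral_le_lintegral_enorm _) 2).trans ?_
    simpa using lintegral_sq_le (volume.restrict B) (f := fun y => ‖a - φ y‖ₑ)
      (continuous_const.sub hφ).enorm.measurable.aemeasurable
  calc _ ≤ (volume B)⁻¹ ^ 2 * (volume B * ∫⁻ y in B, ‖a - φ y‖ₑ ^ 2) := by gcongr
    _ = (volume B)⁻¹ * ((volume B)⁻¹ * volume B) * ∫⁻ y in B, ‖a - φ y‖ₑ ^ 2 := by ring
    _ = _ := by rw [ENNReal.inv_mul_cancel h0 htop, mul_one]

/-! ### Rellich's inequality -/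

/-- Rellich's inequality on `U ∩ W`: up to finitely many continuous functionals on `L²(U)`, the
`L²(U ∩ W)` norm is an arbitrarily small multiple of the `L²(U)` norm of the gradient. -/
def RellichOn (U W : Set (E n)) : Prop :=
  ∀ ε : ℝ, 0 < ε → ∃ (ι : Type) (_ : Fintype ι) (b : ι → L2 U) (C : ℝ), 0 ≤ C ∧
    ∀ φ : E n → ℝ, ContDiff ℝ 1 φ →
      ∫⁻ x in U ∩ W, ‖φ x‖ₑ ^ 2 ≤ ENNReal.ofReal ε * (∫⁻ x in U, ‖fderiv ℝ φ x‖ₑ ^ 2) +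
        ENNReal.ofReal C * ∑ i, ‖∫ x in U, b i x * φ x‖ₑ ^ 2

theorem rellichOn_empty (U : Set (E n)) : RellichOn U ∅ := fun _ _ =>
  ⟨Empty, inferInstance, Empty.elim, 0, le_rfl, fun _ _ => by simp⟩

theorem RellichOn.mono {U W W' : Set (E n)} (hW : W ⊆ W') (h : RellichOn U W') :
    RellichOn U W := fun ε hε => by
  obtain ⟨ι, hι, b, C, hC, hb⟩ := h ε hε
  exact ⟨ι, hι, b, C, hC, fun φ hφ =>
    (lintegral_mono_set (inter_subset_inter_right U hW)).trans (hb φ hφ)⟩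

/-- Split `ε` in half and pool the two families of functionals. With `rellichOn_empty` and
`RellichOn.mono`, this reduces the inequality on a compact set to neighbourhoods of its points. -/
theorem RellichOn.union {U W W' : Set (E n)} (h : RellichOn U W) (h' : RellichOn U W') :
    RellichOn U (W ∪ W') := fun ε hε => by
  obtain ⟨ι, hι, b, C, hC, hb⟩ := h (ε / 2) (by positivity)
  obtain ⟨ι', hι', b', C', hC', hb'⟩ := h' (ε / 2) (by positivity)
  refine ⟨ι ⊕ ι', inferInstance, Sum.elim b b', C + C', by positivity, fun φ hφ => ?_⟩
  rw [inter_union_distrib_left, Fintype.sum_sum_type]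
  refine (lintegral_union_le _ _ _).trans ((add_le_add (hb φ hφ) (hb' φ hφ)).trans ?_)
  simp only [Sum.elim_inl, Sum.elim_inr]
  rw [ENNReal.ofReal_add hC hC']
  set D := ∫⁻ x in U, ‖fderiv ℝ φ x‖ₑ ^ 2
  set s := ∑ i, ‖∫ x in U, b i x * φ x‖ₑ ^ 2
  set s' := ∑ i, ‖∫ x in U, b' i x * φ x‖ₑ ^ 2
  have e : ENNReal.ofReal ε * D = ENNReal.ofReal (ε / 2) * D + ENNReal.ofReal (ε / 2) * D := by
    rw [← add_mul, ← ENNReal.ofReal_add (by positivity) (by positivity), add_halves]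
  calc _ = ENNReal.ofReal ε * D + (ENNReal.ofReal C * s + ENNReal.ofReal C' * s') := by
        rw [e]; ring
    _ ≤ ENNReal.ofReal ε * D + (ENNReal.ofReal C * (s + s') + ENNReal.ofReal C' * (s + s')) := by
        gcongr
        · exact le_self_add
        · exact le_add_self
    _ = _ := by ring

/-- A totally bounded set can be discretized by a simple function at any scale. -/
theorem exists_simpleFunc_dist_lt {U : Set (E n)} (hU : Bornology.IsBounded U) {d : ℝ}
    (hd : 0 < d) : ∃ g : SimpleFunc (E n) (E n), ∀ x ∈ U, dist (g x) x < d := by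
  obtain ⟨F, hF, hUF⟩ := Metric.totallyBounded_iff.1 (hU.isCompact_closure.totallyBounded.subset subset_closure) d hd
  obtain rfl | hne := F.eq_empty_or_nonempty
  · have : U = ∅ := by simpa [subset_empty_iff] using hUF
    exact ⟨SimpleFunc.const _ 0, by simp [this]⟩
  obtain ⟨e, rfl⟩ := hF.countable.exists_eq_range hne
  -- `nearestPt e N` searches only `e 0, …, e N`; `N` is taken large enough for these indices to
  -- exhaust the finite net.
  obtain ⟨k, hk⟩ : ∃ k : E n → ℕ, ∀ y ∈ range e, e (k y) = y :=
    ⟨Function.invFun e, fun y hy => Function.invFun_eq hy⟩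
  refine ⟨SimpleFunc.nearestPt e (hF.toFinset.sup k), fun x hx => ?_⟩
  obtain ⟨y, hy, hxy⟩ := mem_iUnion₂.1 (hUF hx)
  have h1 := SimpleFunc.edist_nearestPt_le e x
    (Finset.le_sup (f := k) (hF.mem_toFinset.2 hy))
  rw [hk y hy, edist_dist, edist_dist, ENNReal.ofReal_le_ofReal_iff dist_nonneg] at h1
  rw [Metric.mem_ball, dist_comm] at hxy
  exact h1.trans_lt hxy

/-- Averages over small balls, translated along a cone of directions that stay inside `U`,
approximate `φ` in `L²`. -/
theorem lintegral_sub_average_le {U S : Set (E n)} (hS : MeasurableSet S) {e : E n} {r t : ℝ}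
    (ht : 0 < t) (hr : 0 < r)
    (h : ∀ x ∈ S, ∀ s ∈ Icc 0 t, ∀ v, ‖v - e‖ < r → x + s • v ∈ U)
    (g : E n → E n) (hg : ∀ x ∈ S, dist (g x) x < t * r / 2) {φ : E n → ℝ} (hφ : ContDiff ℝ 1 φ) :
    ∫⁻ x in S, ‖φ x - (volume.real (Metric.ball (g x + t • e) (t * r / 2)))⁻¹ *
        ∫ y in Metric.ball (g x + t • e) (t * r / 2), φ y‖ₑ ^ 2 ≤
      ENNReal.ofReal (2 ^ n * (t * (‖e‖ + r)) ^ 2) * ∫⁻ x in U, ‖fderiv ℝ φ x‖ₑ ^ 2 := by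
  set d := t * r / 2 with hd
  have hd0 : 0 < d := by positivity
  set V := volume (Metric.ball (0 : E n) d) with hV
  have hV0 : V ≠ 0 := (Metric.measure_ball_pos volume 0 hd0).ne'
  have hVt : V ≠ ⊤ := measure_ball_lt_top.ne
  have hVc : ∀ c : E n, volume (Metric.ball c d) = V := fun c =>
    Measure.addHaar_ball_center volume c d
  -- One set of displacements for all `x`: as `g x` is within `d` of `x`, the averaging ball lies in
  -- `x + Z`. Since `2 * d = t * r`, `Z` is `t` times the ball of radius `r` about `e`, so the cone
  -- hypothesis covers it. The factor `2 ^ n` in the estimate is the ratio of volumes.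
  set Z := Metric.ball (t • e) (2 * d) with hZ
  have hZV : volume Z = ENNReal.ofReal (2 ^ n) * V := by
    rw [hZ, Measure.addHaar_ball_mul_of_pos volume _ two_pos, finrank_euclideanSpace_fin]
  have hZe : ∀ z ∈ Z, ∃ v, ‖v - e‖ < r ∧ z = t • v ∧ ‖z‖ ≤ t * (‖e‖ + r) := by
    intro z hz
    have hz' : ‖z - t • e‖ < t * r := by
      have := mem_ball_iff_norm.1 hz
      rwa [hd, mul_div_cancel₀ _ two_ne_zero] at this
    have e1 : z = t • (t⁻¹ • z) := by rw [smul_smul, mul_inv_cancel₀ ht.ne', one_smul]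
    have h1 : ‖t⁻¹ • z - e‖ < r := by
      have : z - t • e = t • (t⁻¹ • z - e) := by rw [smul_sub, ← e1]
      rw [this, norm_smul, Real.norm_of_nonneg ht.le] at hz'
      exact lt_of_mul_lt_mul_left hz' ht.le
    refine ⟨t⁻¹ • z, h1, e1, ?_⟩
    calc ‖z‖ = ‖t • e + (z - t • e)‖ := by rw [add_sub_cancel]
      _ ≤ ‖t • e‖ + ‖z - t • e‖ := norm_add_le _ _
      _ ≤ t * ‖e‖ + t * r := by
        rw [norm_smul, Real.norm_of_nonneg ht.le]; linarith
      _ = _ := by ring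
  set D := ∫⁻ x in U, ‖fderiv ℝ φ x‖ₑ ^ 2 with hD
  have hpt : ∀ x ∈ S, ‖φ x - (volume.real (Metric.ball (g x + t • e) d))⁻¹ *
      ∫ y in Metric.ball (g x + t • e) d, φ y‖ₑ ^ 2 ≤
      V⁻¹ * ∫⁻ z in Z, ‖φ x - φ (x + z)‖ₑ ^ 2 := by
    intro x hx
    refine (enorm_sub_average_sq_le hφ.continuous (φ x) Metric.isBounded_ball
      (by rwa [hVc])).trans ?_
    rw [hVc]
    gcongr V⁻¹ * ?_
    have hsub : (fun z => x + z) ⁻¹' Metric.ball (g x + t • e) d ⊆ Z := by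
      intro z hz
      have hz1 : ‖x + z - (g x + t • e)‖ < d := mem_ball_iff_norm.1 hz
      have hz2 : ‖g x - x‖ < d := by rw [← dist_eq_norm]; exact hg x hx
      refine mem_ball_iff_norm.2 ?_
      calc ‖z - t • e‖ = ‖(x + z - (g x + t • e)) + (g x - x)‖ := by congr 1; abel
        _ ≤ _ := norm_add_le _ _
        _ < 2 * d := by linarith
    rw [← (measurePreserving_add_left volume x).setLIntegral_comp_preimage_emb
      (measurableEmbedding_addLeft x) (fun y => ‖φ x - φ y‖ₑ ^ 2)]
    exact lintegral_mono_set hsub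
  have hm : Measurable fun p : E n × E n => ‖φ p.1 - φ (p.1 + p.2)‖ₑ ^ 2 :=
    ((hφ.continuous.comp continuous_fst).sub
      (hφ.continuous.comp (continuous_fst.add continuous_snd))).enorm.measurable.pow_const 2
  calc _ ≤ ∫⁻ x in S, V⁻¹ * ∫⁻ z in Z, ‖φ x - φ (x + z)‖ₑ ^ 2 := setLIntegral_mono' hS hpt
    -- Tonelli: for a fixed displacement `z` the translation estimate applies.
    _ = V⁻¹ * ∫⁻ z in Z, ∫⁻ x in S, ‖φ x - φ (x + z)‖ₑ ^ 2 := by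
      rw [lintegral_const_mul' _ _ (ENNReal.inv_ne_top.2 hV0),
        lintegral_lintegral_swap hm.aemeasurable]
    _ ≤ V⁻¹ * ∫⁻ _ in Z, ENNReal.ofReal ((t * (‖e‖ + r)) ^ 2) * D := by
      gcongr V⁻¹ * ?_
      refine setLIntegral_mono' Metric.isOpen_ball.measurableSet fun z hz => ?_
      obtain ⟨v, hv, hzv, hzn⟩ := hZe z hz
      refine (lintegral_translate_sub_le (U := U) hφ z fun x hx s hs => ?_).trans ?_
      · rw [hzv, smul_smul]
        exact h x hx _ ⟨by have := hs.1; positivity, by nlinarith [hs.2]⟩ v hv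
      · gcongr
        rw [← ofReal_norm, ← ENNReal.ofReal_pow (norm_nonneg _)]
        gcongr
    _ = _ := by
      rw [setLIntegral_const, hZV, ENNReal.ofReal_mul (by positivity)]
      calc _ = (V⁻¹ * V) * (ENNReal.ofReal (2 ^ n) *
            ENNReal.ofReal ((t * (‖e‖ + r)) ^ 2) * D) := by ring
        _ = _ := by rw [ENNReal.inv_mul_cancel hV0 hVt, one_mul]

/-- Represents averaging over a ball inside `U` as pairing with an element of `L²(U)`, the form of
functional that `RellichOn` requires. -/
theorem integral_indicatorConstLp_mul {U B : Set (E n)} (hB : MeasurableSet B)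
    (hBU : B ⊆ U) (hμ : volume.restrict U B ≠ ⊤) (c : ℝ) (φ : E n → ℝ) :
    ∫ x in U, (indicatorConstLp 2 hB hμ c : L2 U) x * φ x = c * ∫ x in B, φ x := by
  have e : (fun x => (indicatorConstLp 2 hB hμ c : L2 U) x * φ x) =ᵐ[volume.restrict U]
      B.indicator fun x => c * φ x := by
    filter_upwards [indicatorConstLp_coeFn (hs := hB) (hμs := hμ) (c := c) (p := 2)] with x hx
    rw [hx]
    by_cases hxB : x ∈ B <;> simp [hxB]
  rw [integral_congr_ae e, integral_indicator hB, Measure.restrict_restrict hB,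
    inter_eq_self_of_subset_left hBU, integral_const_mul]

/-- Rellich's inequality on a piece of `U` satisfying a uniform cone condition. -/
theorem rellichOn_of_cone {U W : Set (E n)} (hU : IsOpen U) (hUb : Bornology.IsBounded U)
    (hW : MeasurableSet W) {e : E n} {r τ : ℝ} (hr : 0 < r) (hτ : 0 < τ)
    (h : ∀ x ∈ U ∩ W, ∀ s ∈ Icc 0 τ, ∀ v, ‖v - e‖ < r → x + s • v ∈ U) : RellichOn U W := by
  intro ε hε
  -- The extra factor 2 anticipates `|a|² ≤ 2 |a - c|² + 2 |c|²`, which separates `φ` from its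
  -- averages.
  obtain ⟨t, ⟨ht, htτ⟩, htε⟩ : ∃ t : ℝ, t ∈ Ioc 0 τ ∧
      2 * (2 ^ n * (t * (‖e‖ + r)) ^ 2) < ε := by
    have hc : Continuous fun t : ℝ => 2 * (2 ^ n * (t * (‖e‖ + r)) ^ 2) := by fun_prop
    have h1 : ∀ᶠ t in 𝓝[>] (0 : ℝ), 2 * (2 ^ n * (t * (‖e‖ + r)) ^ 2) < ε := by
      refine ((hc.tendsto 0).mono_left nhdsWithin_le_nhds).eventually_lt_const ?_
      simpa using hε
    exact (Filter.Eventually.and (Ioc_mem_nhdsGT hτ) h1).exists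
  have hd0 : 0 < t * r / 2 := by positivity
  obtain ⟨g, hg⟩ := exists_simpleFunc_dist_lt hUb hd0
  have hS : MeasurableSet (U ∩ W) := hU.measurableSet.inter hW
  let B : E n → Set (E n) := fun c => Metric.ball (c + t • e) (t * r / 2)
  have hBf : ∀ c, volume.restrict U (B c) ≠ ⊤ := fun c =>
    ((Measure.restrict_apply_le _ _).trans_lt measure_ball_lt_top).ne
  obtain ⟨b, hb⟩ : ∃ b : E n → L2 U, ∀ c, B c ⊆ U → ∀ φ : E n → ℝ,
      ∫ x in U, b c x * φ x = (volume.real (B c))⁻¹ * ∫ x in B c, φ x :=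
    ⟨fun c => indicatorConstLp 2 (Metric.isOpen_ball.measurableSet : MeasurableSet (B c)) (hBf c)
      (volume.real (B c))⁻¹, fun c hc φ => integral_indicatorConstLp_mul _ hc (hBf c) _ φ⟩
  have hBU : ∀ x ∈ U ∩ W, B (g x) ⊆ U := by
    intro x hx y hy
    have hz1 : ‖y - (g x + t • e)‖ < t * r / 2 := mem_ball_iff_norm.1 hy
    have hz2 : ‖g x - x‖ < t * r / 2 := by rw [← dist_eq_norm]; exact hg x hx.1
    have e1 : y = x + t • (t⁻¹ • (y - x)) := by
      rw [smul_smul, mul_inv_cancel₀ ht.ne', one_smul, add_sub_cancel]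
    rw [e1]
    refine h x hx t ⟨ht.le, htτ⟩ _ ?_
    have e2 : t • (t⁻¹ • (y - x) - e) = (y - (g x + t • e)) + (g x - x) := by
      rw [smul_sub, smul_smul, mul_inv_cancel₀ ht.ne', one_smul]; abel
    have h3 : ‖t • (t⁻¹ • (y - x) - e)‖ < t * r := by
      rw [e2]; exact (norm_add_le _ _).trans_lt (by linarith)
    rw [norm_smul, Real.norm_of_nonneg ht.le] at h3
    exact lt_of_mul_lt_mul_left h3 ht.le
  -- One functional per value of `g`, finitely many in all. At each point the squared average is one
  -- summand of their sum; integrating over `U ∩ W` costs at most the volume of `U`.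
  refine ⟨g.range, inferInstance, fun c => b c, 2 * volume.real U, by positivity, fun φ hφ => ?_⟩
  set m : E n → ℝ := fun x => ∫ y in U, b (g x) y * φ y with hm
  have hmB : ∀ x ∈ U ∩ W, m x = (volume.real (B (g x)))⁻¹ * ∫ y in B (g x), φ y := fun x hx =>
    hb _ (hBU x hx) φ
  have hmm : Measurable m := (g.map fun c => ∫ y in U, b c y * φ y).measurable
  obtain ⟨F, hF⟩ : ∃ F : E n → ℝ≥0∞, ∀ c, F c = ‖∫ x in U, b c x * φ x‖ₑ ^ 2 := ⟨_, fun _ => rfl⟩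
  simp only [← hF]
  set Q := ∑ i : g.range, F i with hQ
  have hFQ : ∀ x, ‖m x‖ₑ ^ 2 ≤ Q := fun x => by
    rw [hm, ← hF, hQ]
    exact Finset.single_le_sum (f := fun i : g.range => F i) (fun _ _ => zero_le)
      (Finset.mem_univ ⟨g x, g.mem_range_self x⟩)
  have h1 : ∫⁻ x in U ∩ W, ‖φ x - m x‖ₑ ^ 2 ≤
      ENNReal.ofReal (2 ^ n * (t * (‖e‖ + r)) ^ 2) * ∫⁻ x in U, ‖fderiv ℝ φ x‖ₑ ^ 2 := by
    refine le_trans (le_of_eq ?_) (lintegral_sub_average_le hS ht hr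
      (fun x hx s hs => h x hx s ⟨hs.1, hs.2.trans htτ⟩) g (fun x hx => hg x hx.1) hφ)
    exact setLIntegral_congr_fun hS fun x hx => by simp only [hmB x hx, B]
  have h2 : ∫⁻ x in U ∩ W, ‖m x‖ₑ ^ 2 ≤ ENNReal.ofReal (volume.real U) * Q := by
    calc ∫⁻ x in U ∩ W, ‖m x‖ₑ ^ 2 ≤ ∫⁻ _ in U ∩ W, Q := lintegral_mono hFQ
      _ = Q * volume (U ∩ W) := setLIntegral_const _ _
      _ ≤ Q * volume U := by gcongr; exact inter_subset_left
      _ = _ := by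
        rw [Measure.real, ENNReal.ofReal_toReal hUb.measure_lt_top.ne, mul_comm]
  have hsq : ∀ a c : ℝ, ‖a‖ₑ ^ 2 ≤ 2 * ‖a - c‖ₑ ^ 2 + 2 * ‖c‖ₑ ^ 2 := by
    intro a c
    have e2 : (2 : ℝ≥0∞) = ENNReal.ofReal 2 := by simp
    simp only [Real.enorm_eq_ofReal_abs, ← ENNReal.ofReal_pow (abs_nonneg _), sq_abs, e2]
    rw [← ENNReal.ofReal_mul (by norm_num), ← ENNReal.ofReal_mul (by norm_num),
      ← ENNReal.ofReal_add (by positivity) (by positivity)]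
    exact ENNReal.ofReal_le_ofReal (by nlinarith [sq_nonneg (a - 2 * c)])
  calc ∫⁻ x in U ∩ W, ‖φ x‖ₑ ^ 2
      ≤ ∫⁻ x in U ∩ W, (2 * ‖φ x - m x‖ₑ ^ 2 + 2 * ‖m x‖ₑ ^ 2) :=
        lintegral_mono fun x => hsq _ _
    _ = 2 * (∫⁻ x in U ∩ W, ‖φ x - m x‖ₑ ^ 2) + 2 * ∫⁻ x in U ∩ W, ‖m x‖ₑ ^ 2 := by
        rw [lintegral_add_right _ ((hmm.enorm.pow_const 2).const_mul 2),
          lintegral_const_mul' _ _ (by simp), lintegral_const_mul' _ _ (by simp)]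
    _ ≤ 2 * (ENNReal.ofReal (2 ^ n * (t * (‖e‖ + r)) ^ 2) * ∫⁻ x in U, ‖fderiv ℝ φ x‖ₑ ^ 2) +
        2 * (ENNReal.ofReal (volume.real U) * Q) := by gcongr
    _ = ENNReal.ofReal (2 * (2 ^ n * (t * (‖e‖ + r)) ^ 2)) * (∫⁻ x in U, ‖fderiv ℝ φ x‖ₑ ^ 2) +
        ENNReal.ofReal (2 * volume.real U) * Q := by
        rw [ENNReal.ofReal_mul zero_le_two, ENNReal.ofReal_mul zero_le_two, mul_assoc, mul_assoc]
        simp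
    _ ≤ _ := by gcongr

/-! ### Cones at boundary points, and patching over the closure -/

/-- Near a boundary point, `U` contains a cone of fixed aperture, direction and height at each of
its points. -/
theorem IsDefiningFun.exists_cone {U : Set (E n)} {x₀ : E n} {ρ : E n → ℝ}
    (h : IsDefiningFun U x₀ ρ) : ∃ W ∈ 𝓝 x₀, IsOpen W ∧ ∃ (e : E n) (r τ : ℝ), 0 < r ∧ 0 < τ ∧
      ∀ x ∈ U ∩ W, ∀ s ∈ Icc 0 τ, ∀ v, ‖v - e‖ < r → x + s • v ∈ U := by
  have hdiff : Differentiable ℝ ρ := h.smooth.differentiable (by simp)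
  have hcont : Continuous (fderiv ℝ ρ) := h.smooth.continuous_fderiv (by simp)
  set e : E n := -gradient ρ x₀ with he
  have hneg : fderiv ℝ ρ x₀ e < 0 := by
    have h1 : fderiv ℝ ρ x₀ (gradient ρ x₀) = ‖gradient ρ x₀‖ ^ 2 := by
      rw [← real_inner_self_eq_norm_sq, ← (hdiff x₀).hasGradientAt.fderiv_apply]
    rw [he, map_neg, h1]
    have := norm_pos_iff.2 h.gradient_ne
    simpa using by positivity
  -- `ρ` decreases strictly in the inward direction `e` at `x₀`, and by joint continuity also at
  -- nearby points in nearby directions.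
  have hev : ∀ᶠ p : E n × E n in 𝓝 (x₀, e), fderiv ℝ ρ p.1 p.2 < 0 ∧ (p.1 ∈ U ↔ ρ p.1 < 0) := by
    have hc : Continuous fun p : E n × E n => fderiv ℝ ρ p.1 p.2 :=
      (hcont.comp continuous_fst).clm_apply continuous_snd
    exact ((hc.tendsto (x₀, e)).eventually_lt_const hneg).and
      ((continuous_fst.tendsto (x₀, e)).eventually h.local_eq)
  obtain ⟨δ, hδ, hδ'⟩ := Metric.eventually_nhds_iff_ball.1 hev
  have hK : 0 < ‖e‖ + δ := by positivity
  -- The height makes each segment at most `δ / 2` long, so starting within `δ / 2` of `x₀` it stays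
  -- in the `δ`-ball. There `ρ` does not increase along it, hence stays negative.
  refine ⟨Metric.ball x₀ (δ / 2), Metric.ball_mem_nhds _ (by positivity), Metric.isOpen_ball, e, δ,
    δ / 2 / (‖e‖ + δ), hδ, by positivity, ?_⟩
  rintro x ⟨hxU, hx⟩ s hs v hv
  have hvn : ‖v‖ ≤ ‖e‖ + δ := by
    calc ‖v‖ = ‖e + (v - e)‖ := by rw [add_sub_cancel]
      _ ≤ _ := (norm_add_le _ _).trans (by linarith)
  have hmem : ∀ σ ∈ Icc 0 s, (x + σ • v, v) ∈ Metric.ball (x₀, e) δ := by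
    intro σ hσ
    rw [← ball_prod_same]
    refine ⟨?_, mem_ball_iff_norm.2 hv⟩
    have h1 : ‖σ • v‖ ≤ δ / 2 := by
      rw [norm_smul, Real.norm_of_nonneg hσ.1]
      calc σ * ‖v‖ ≤ (δ / 2 / (‖e‖ + δ)) * (‖e‖ + δ) := by
            gcongr
            exact hσ.2.trans hs.2
        _ = δ / 2 := by field_simp
    have h2 : ‖x - x₀‖ < δ / 2 := mem_ball_iff_norm.1 hx
    refine mem_ball_iff_norm.2 ?_
    calc ‖x + σ • v - x₀‖ = ‖(x - x₀) + σ • v‖ := by congr 1; abel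
      _ ≤ _ := norm_add_le _ _
      _ < δ := by linarith
  have hd : ∀ σ : ℝ, HasDerivAt (fun σ : ℝ => ρ (x + σ • v)) (fderiv ℝ ρ (x + σ • v) v) σ := by
    intro σ
    have h1 : HasDerivAt (fun s : ℝ => x + s • v) v σ := by
      simpa using ((hasDerivAt_id σ).smul_const v).const_add x
    exact (hdiff _).hasFDerivAt.comp_hasDerivAt σ h1
  have hanti : AntitoneOn (fun σ : ℝ => ρ (x + σ • v)) (Icc 0 s) :=
    antitoneOn_of_deriv_nonpos (convex_Icc 0 s) (fun σ _ => (hd σ).continuousAt.continuousWithinAt)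
      (fun σ _ => (hd σ).differentiableAt.differentiableWithinAt) fun σ hσ => by
        rw [(hd σ).deriv]
        exact (hδ' _ (hmem σ (interior_subset hσ))).1.le
  have h0 := (hδ' _ (hmem 0 ⟨le_rfl, hs.1⟩)).2
  simp only [zero_smul, add_zero] at h0
  have hle := hanti ⟨le_rfl, hs.1⟩ ⟨hs.1, le_rfl⟩ hs.1
  simp only [zero_smul, add_zero] at hle
  exact (hδ' _ (hmem s ⟨hs.1, le_rfl⟩)).2.2 (hle.trans_lt (h0.1 hxU))

/-- Rellich's inequality for a bounded open set with smooth boundary. -/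
theorem rellichOn_closure {U : Set (E n)} (hU : IsOpen U) (hUb : Bornology.IsBounded U)
    (hUs : HasSmoothBoundary U) : RellichOn U (closure U) := by
  refine hUb.isCompact_closure.induction_on (rellichOn_empty U) (fun _ _ hst h => h.mono hst)
    (fun _ _ h h' => h.union h') fun x hx => ?_
  by_cases hxU : x ∈ U
  -- At an interior point no direction is preferred: with `e = 0` the cone is a full ball.
  · obtain ⟨δ, hδ, hball⟩ := Metric.isOpen_iff.1 hU x hxU
    refine ⟨Metric.ball x (δ / 2), mem_nhdsWithin_of_mem_nhds
      (Metric.ball_mem_nhds _ (by positivity)), rellichOn_of_cone (e := 0) (r := δ / 2) (τ := 1) hU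
      hUb Metric.isOpen_ball.measurableSet (by positivity) one_pos ?_⟩
    rintro y ⟨-, hy⟩ s ⟨hs0, hs1⟩ v hv
    refine hball (mem_ball_iff_norm.2 ?_)
    have h1 : ‖y - x‖ < δ / 2 := mem_ball_iff_norm.1 hy
    rw [sub_zero] at hv
    calc ‖y + s • v - x‖ = ‖(y - x) + s • v‖ := by congr 1; abel
      _ ≤ ‖y - x‖ + ‖s • v‖ := norm_add_le _ _
      _ ≤ ‖y - x‖ + 1 * ‖v‖ := by
        rw [norm_smul, Real.norm_of_nonneg hs0]; gcongr
      _ < δ := by linarith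
  · obtain ⟨ρ, hρ⟩ := hUs x (hU.frontier_eq ▸ ⟨hx, hxU⟩)
    obtain ⟨W, hW, hWo, e, r, τ, hr, hτ, h⟩ := hρ.exists_cone
    exact ⟨W, mem_nhdsWithin_of_mem_nhds hW, rellichOn_of_cone hU hUb hWo.measurableSet hr hτ h⟩

open scoped InnerProductSpace

/-! ### Rellich's inequality in the Sobolev space -/

theorem mderiv_zero (φ : E n → ℝ) : mderiv 0 φ = φ := by
  unfold mderiv
  induction List.finRange n with
  | nil => rfl
  | cons i l ih => simp

theorem mderiv_single (i : Fin n) (φ : E n → ℝ) : mderiv (Pi.single i 1) φ = pderiv i φ := by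
  have key : ∀ l : List (Fin n), l.Nodup →
      l.foldr (fun j g => (pderiv j)^[(Pi.single i 1 : Fin n → ℕ) j] g) φ =
        if i ∈ l then pderiv i φ else φ := by
    intro l
    induction l with
    | nil => simp
    | cons j l ih =>
      intro hl
      rw [List.nodup_cons] at hl
      rw [List.foldr_cons, ih hl.2]
      by_cases hij : j = i
      · subst hij
        simp [hl.1]
      · simp [hij, Ne.symm hij]
  exact (key _ (List.nodup_finRange n)).trans (if_pos (List.mem_finRange i))

theorem single_mem_multiIdx (i : Fin n) {m : ℕ} (hm : 1 ≤ m) : Pi.single i 1 ∈ multiIdx n m :=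
  mem_multiIdx.2 (by simpa using hm)

theorem zero_mem_multiIdx (m : ℕ) : (0 : Fin n → ℕ) ∈ multiIdx n m := mem_multiIdx.2 (by simp)

/-- By the Riesz isometry the operator norm of the differential is the Euclidean norm of the
gradient. -/
theorem enorm_fderiv_sq (φ : E n → ℝ) (x : E n) :
    ‖fderiv ℝ φ x‖ₑ ^ 2 = ∑ i, ‖pderiv i φ x‖ₑ ^ 2 := by
  have h : ‖fderiv ℝ φ x‖ ^ 2 = ∑ i, ‖pderiv i φ x‖ ^ 2 := by
    rw [← ((InnerProductSpace.toDual ℝ (E n)).symm.norm_map (fderiv ℝ φ x)),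
      EuclideanSpace.norm_sq_eq]
    refine Finset.sum_congr rfl fun i _ => ?_
    rw [pderiv, ← InnerProductSpace.toDual_symm_apply, EuclideanSpace.inner_single_right]
    simp
  have e : ∀ {F : Type} [NormedAddCommGroup F] (a : F), ‖a‖ₑ ^ 2 = ENNReal.ofReal (‖a‖ ^ 2) :=
    fun a => by rw [← ofReal_norm, ENNReal.ofReal_pow (norm_nonneg _)]
  simp only [e]
  rw [h, ENNReal.ofReal_sum_of_nonneg fun _ _ => sq_nonneg _]

theorem ofReal_norm_sq_eq_lintegral {μ : Measure (E n)} {f : E n → ℝ} {Φ : Lp ℝ 2 μ}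
    (h : Φ =ᵐ[μ] f) : ENNReal.ofReal (‖Φ‖ ^ 2) = ∫⁻ x, ‖f x‖ₑ ^ 2 ∂μ := by
  have h1 := eLpNorm_nnreal_pow_eq_lintegral (f := f) (μ := μ) (p := 2) (by norm_num)
  rw [← eLpNorm_congr_ae h] at h1
  rw [ENNReal.ofReal_pow (norm_nonneg _), ofReal_norm, Lp.enorm_def]
  simp only [NNReal.coe_ofNat, ENNReal.coe_ofNat, ENNReal.rpow_ofNat] at h1
  exact h1

theorem inner_eq_integral_mul {μ : Measure (E n)} (u v : Lp ℝ 2 μ) :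
    ⟪u, v⟫_ℝ = ∫ x, u x * v x ∂μ := by
  rw [L2.inner_def]
  exact integral_congr_ae (Eventually.of_forall fun x => by simp [mul_comm])

/-- Rellich's inequality for restrictions of smooth functions. -/
theorem RellichOn.exists_norm_sq_le {U : Set (E n)} (h : RellichOn U (closure U)) {ε : ℝ}
    (hε : 0 < ε) : ∃ (ι : Type) (_ : Fintype ι) (b : ι → L2 U) (C : ℝ),
      ∀ φ : E n → ℝ, ContDiff ℝ ∞ φ → ∀ (Φ : L2 U) (Φ' : Fin n → L2 U),
        Φ =ᵐ[volume.restrict U] φ → (∀ i, Φ' i =ᵐ[volume.restrict U] pderiv i φ) →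
        ‖Φ‖ ^ 2 ≤ ε * ∑ i, ‖Φ' i‖ ^ 2 + C * ∑ j, ⟪b j, Φ⟫_ℝ ^ 2 := by
  obtain ⟨ι, hι, b, C, hC, hb⟩ := h ε hε
  refine ⟨ι, hι, b, C, fun φ hφ Φ Φ' h1 h2 => ?_⟩
  have key := hb φ (hφ.of_le (by simp))
  have e1 : ∫⁻ x in U, ‖fderiv ℝ φ x‖ₑ ^ 2 = ENNReal.ofReal (∑ i, ‖Φ' i‖ ^ 2) := by
    rw [ENNReal.ofReal_sum_of_nonneg fun _ _ => sq_nonneg _]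
    simp only [enorm_fderiv_sq]
    rw [lintegral_finsetSum _ fun i _ =>
      ((contDiff_pderiv i hφ).continuous.enorm.measurable.pow_const 2)]
    exact Finset.sum_congr rfl fun i _ => (ofReal_norm_sq_eq_lintegral (h2 i)).symm
  have e2 : ∀ j, ‖∫ x in U, b j x * φ x‖ₑ ^ 2 = ENNReal.ofReal (⟪b j, Φ⟫_ℝ ^ 2) := by
    intro j
    have : ∫ x in U, b j x * φ x = ⟪b j, Φ⟫_ℝ := by
      rw [inner_eq_integral_mul]
      exact integral_congr_ae (by filter_upwards [h1] with x hx; rw [hx])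
    rw [this, Real.enorm_eq_ofReal_abs, ← ENNReal.ofReal_pow (abs_nonneg _), sq_abs]
  simp only [e1, e2] at key
  rw [inter_eq_self_of_subset_left subset_closure, ← ofReal_norm_sq_eq_lintegral h1,
    ← ENNReal.ofReal_sum_of_nonneg fun _ _ => sq_nonneg _, ← ENNReal.ofReal_mul hε.le,
    ← ENNReal.ofReal_mul hC, ← ENNReal.ofReal_add (by positivity) (by positivity)] at key
  exact (ENNReal.ofReal_le_ofReal_iff (by positivity)).1 key

theorem memLp_restrict_of_continuous {U : Set (E n)} (hU : Bornology.IsBounded U)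
    {φ : E n → ℝ} (hφ : Continuous φ) : MemLp φ 2 (volume.restrict U) := by
  have : IsFiniteMeasure (volume.restrict U) := ⟨by simpa using hU.measure_lt_top⟩
  obtain ⟨C, hC⟩ := hU.isCompact_closure.exists_bound_of_continuousOn hφ.continuousOn
  refine MemLp.of_bound hφ.aestronglyMeasurable C ?_
  exact ae_restrict_of_ae_restrict_of_subset subset_closure
    (ae_restrict_of_forall_mem isClosed_closure.measurableSet hC)

theorem weakDeriv_index_zero {U : Set (E n)} (hU : IsOpen U) (u : L2 U) : weakDeriv U 0 u = u := by
  have h0 : IsWeakDeriv U 0 u u := fun φ _ => by simp [mderiv_zero]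
  have h : ∃ v, IsWeakDeriv U 0 u v := ⟨u, h0⟩
  rw [weakDeriv, dif_pos h]
  exact h.choose_spec.unique hU h0

/-- Rellich's inequality for functions in `H¹(U)` that have a boundary trace. -/
theorem RellichOn.exists_norm_sq_le_of_isTrace {U : Set (E n)} (h : RellichOn U (closure U))
    (hU : IsOpen U) (hUb : Bornology.IsBounded U) {ε : ℝ} (hε : 0 < ε) :
    ∃ (ι : Type) (_ : Fintype ι) (b : ι → L2 U) (C : ℝ), ∀ (v : L2 U) (g : L2Boundary U),
      IsTrace U v g →
        ‖v‖ ^ 2 ≤ ε * ∑ i, ‖weakDeriv U (Pi.single i 1) v‖ ^ 2 + C * ∑ j, ⟪b j, v⟫_ℝ ^ 2 := by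
  obtain ⟨ι, hι, b, C, hb⟩ := h.exists_norm_sq_le hε
  -- The definition of trace supplies smooth `φ k` tending to `v` in `H¹(U)`. Both sides of the
  -- inequality are continuous in that norm.
  refine ⟨ι, hι, b, C, fun v g ⟨_, φ, hφ, hlim, _⟩ => ?_⟩
  have hmem : ∀ (α : Fin n → ℕ) k, MemLp (mderiv α (φ k)) 2 (volume.restrict U) := fun α k =>
    memLp_restrict_of_continuous hUb (contDiff_mderiv α (hφ k)).continuous
  have ht : ∀ α ∈ multiIdx n 1,
      Tendsto (fun k => (hmem α k).toLp _) atTop (𝓝 (weakDeriv U α v)) := by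
    intro α hα
    rw [Lp.tendsto_Lp_iff_tendsto_eLpNorm']
    refine (hlim α hα).congr fun k => eLpNorm_congr_ae ?_
    filter_upwards [(hmem α k).coeFn_toLp] with x hx
    rw [Pi.sub_apply, hx]
  have h0 := ht 0 (zero_mem_multiIdx 1)
  rw [weakDeriv_index_zero hU] at h0
  refine le_of_tendsto_of_tendsto' (h0.norm.pow 2)
    (((tendsto_finsetSum _ fun i _ =>
      ((ht _ (single_mem_multiIdx i le_rfl)).norm.pow 2)).const_mul ε).add
      ((tendsto_finsetSum _ fun j _ => ((tendsto_const_nhds (x := b j)).inner h0).pow 2).const_mul C))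
    fun k => hb (φ k) (hφ k) _ _ ?_ fun i => ?_
  · simpa only [mderiv_zero] using (hmem 0 k).coeFn_toLp
  · simpa only [mderiv_single] using (hmem (Pi.single i 1) k).coeFn_toLp

/-! ### Compactness of the Green's operator -/

/-- Both sides of the defining identity are `L²` inner products with fixed functions, hence
continuous. This closedness feeds the closed graph theorem. -/
theorem IsWeakDeriv.of_tendsto {U : Set (E n)} {α : Fin n → ℕ} {u v : ℕ → L2 U} {u' v' : L2 U}
    (h : ∀ k, IsWeakDeriv U α (u k) (v k)) (hu : Tendsto u atTop (𝓝 u'))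
    (hv : Tendsto v atTop (𝓝 v')) : IsWeakDeriv U α u' v' := by
  intro φ hφ
  have key : ∀ ψ : E n → ℝ, ContDiff ℝ ∞ ψ → HasCompactSupport ψ → ∀ (w : ℕ → L2 U) (w' : L2 U),
      Tendsto w atTop (𝓝 w') →
      Tendsto (fun k => ∫ x in U, w k x * ψ x) atTop (𝓝 (∫ x in U, w' x * ψ x)) := by
    intro ψ hψ hc w w' hw
    have hm : MemLp ψ 2 (volume.restrict U) :=
      (hψ.continuous.memLp_of_hasCompactSupport hc).restrict U
    have e : ∀ a : L2 U, ∫ x in U, a x * ψ x = ⟪a, hm.toLp ψ⟫_ℝ := fun a => by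
      rw [inner_eq_integral_mul]
      exact integral_congr_ae (by filter_upwards [hm.coeFn_toLp] with x hx; rw [hx])
    simp only [e]
    exact hw.inner tendsto_const_nhds
  refine tendsto_nhds_unique
    (key _ (contDiff_mderiv α hφ.smooth) (hasCompactSupport_mderiv α hφ.compact) u u' hu)
    (((key φ hφ.smooth hφ.compact v v' hv).const_mul ((-1) ^ (∑ i, α i))).congr fun k => ?_)
  exact (h k φ hφ).symm

namespace BoundaryValueProblem

theorem two_le_order {m : ℕ} (P : BoundaryValueProblem n m) : 2 ≤ m := by
  obtain ⟨k, hk⟩ := P.m_even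
  have := P.m_pos
  omega

variable {m : ℕ} (P : BoundaryValueProblem n m)

/-- Since `m ≥ 2` there is at least one boundary condition, and its multi-index 0 refers to `u`
itself. -/
theorem isTrace_of_mem_domain {u : L2 P.U} (hu : u ∈ P.domain) :
    ∃ g : L2Boundary P.U, IsTrace P.U u g := by
  obtain ⟨g, hg, -⟩ := hu.2 ⟨0, Nat.div_pos P.two_le_order two_pos⟩
  refine ⟨g 0, ?_⟩
  have := hg 0 (zero_mem_multiIdx _)
  rwa [weakDeriv_index_zero P.isOpen] at this

theorem green_mem_domain (h : Function.Bijective P.op) (f : L2 P.U) : P.green h f ∈ P.domain :=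
  ((LinearEquiv.ofBijective P.op h).symm f).2

theorem green_op (h : Function.Bijective P.op) (u : P.domain) : P.green h (P.op u) = u :=
  congrArg Subtype.val ((LinearEquiv.ofBijective P.op h).symm_apply_apply u)

theorem green_injective (h : Function.Bijective P.op) : Function.Injective (P.green h) :=
  Subtype.val_injective.comp (LinearEquiv.ofBijective P.op h).symm.injective

/-- The weak derivative `D^α G f` of a solution, as a function of the right-hand side. -/
def greenDeriv (h : Function.Bijective P.op) {α : Fin n → ℕ} (hα : α ∈ multiIdx n m) :
    L2 P.U →ₗ[ℝ] L2 P.U where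
  toFun f := weakDeriv P.U α (P.green h f)
  map_add' f g := by
    have := weakDeriv_add_smul P.isOpen (P.green_mem_domain h f).1 (P.green_mem_domain h g).1 1 hα
    rwa [one_smul, one_smul, ← map_add] at this
  map_smul' c f := by
    have := weakDeriv_add_smul P.isOpen (Submodule.zero_mem _) (P.green_mem_domain h f).1 c hα
    rwa [weakDeriv_zero P.isOpen, zero_add, zero_add, ← map_smul] at this

/-- The Green's operator is bounded from `L²(U)` to `H^m(U)`. -/
theorem continuous_greenDeriv {h : Function.Bijective P.op} (hc : Continuous (P.green h))
    {α : Fin n → ℕ} (hα : α ∈ multiIdx n m) : Continuous (P.greenDeriv h hα) := by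
  -- If `f k → f'` and `D^α G (f k) → v`, then `G (f k) → G f'`, so `v` is the weak derivative of `G
  -- f'`.
  refine LinearMap.continuous_of_seq_closed_graph _ fun f f' v hf hv => ?_
  refine (IsWeakDeriv.of_tendsto (fun k => weakDeriv_spec (P.green_mem_domain h (f k)).1 hα)
    ((hc.tendsto f').comp hf) hv).unique P.isOpen ?_
  exact weakDeriv_spec (P.green_mem_domain h f').1 hα

variable {P}

/-- The Green's operator of an admissible problem, as a bounded operator. -/
def IsAdmissible.greenCLM (hP : P.IsAdmissible) : L2 P.U →L[ℝ] L2 P.U :=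
  ⟨P.green hP.bijective, hP.selfAdjoint.continuous⟩

/-- If `f` is orthogonal to every `G (b j)`, symmetry gives `⟪b j, G f⟫ = 0`. The functionals then
drop out of Rellich's inequality, leaving `‖G f‖` small relative to `‖f‖`. -/
theorem IsAdmissible.isCompactOperator_greenCLM (hP : P.IsAdmissible) :
    IsCompactOperator hP.greenCLM := by
  have hm : 1 ≤ m := one_le_two.trans P.two_le_order
  let D : Fin n → L2 P.U →L[ℝ] L2 P.U := fun i =>
    ⟨P.greenDeriv hP.bijective (single_mem_multiIdx i hm),
      P.continuous_greenDeriv hP.selfAdjoint.continuous _⟩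
  set M : ℝ := ∑ i, ‖D i‖ ^ 2 with hM
  have hM0 : 0 ≤ M := by positivity
  refine isCompactOperator_of_finite_functionals _ fun ε hε => ?_
  -- `M` bounds the squared gradient of `G f` relative to `‖f‖²`; adding 1 covers `M = 0`.
  have hδ : 0 < ε ^ 2 / (M + 1) := by positivity
  obtain ⟨ι, hι, b, C, hb⟩ := (rellichOn_closure P.isOpen P.isBounded
    P.smoothBoundary).exists_norm_sq_le_of_isTrace P.isOpen P.isBounded hδ
  refine ⟨ι, hι, fun j => hP.greenCLM (b j), fun f hf => ?_⟩
  obtain ⟨g, hg⟩ := P.isTrace_of_mem_domain (P.green_mem_domain hP.bijective f)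
  have h1 := hb _ g hg
  have h2 : ∀ j, ⟪b j, P.green hP.bijective f⟫_ℝ = 0 := fun j =>
    (hP.selfAdjoint (b j) f).symm.trans (hf j)
  have h3 : ∑ i, ‖weakDeriv P.U (Pi.single i 1) (P.green hP.bijective f)‖ ^ 2 ≤ M * ‖f‖ ^ 2 := by
    rw [hM, Finset.sum_mul]
    refine Finset.sum_le_sum fun i _ => ?_
    rw [← mul_pow]
    exact pow_le_pow_left₀ (norm_nonneg _) ((D i).le_opNorm f) 2
  simp only [h2, ne_eq, OfNat.ofNat_ne_zero, not_false_eq_true, zero_pow, Finset.sum_const_zero,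
    mul_zero, add_zero] at h1
  refine le_of_sq_le_sq ?_ (by positivity)
  calc ‖P.green hP.bijective f‖ ^ 2 ≤ ε ^ 2 / (M + 1) * (M * ‖f‖ ^ 2) :=
        h1.trans (mul_le_mul_of_nonneg_left h3 hδ.le)
    _ ≤ ε ^ 2 / (M + 1) * ((M + 1) * ‖f‖ ^ 2) := by gcongr; linarith
    _ = (ε * ‖f‖) ^ 2 := by field_simp

/-- The Green's operator of a positive admissible problem is positive definite. -/
theorem IsAdmissible.inner_green_pos (hP : P.IsAdmissible) (hpos : P.IsPositive hP) {f : L2 P.U}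
    (hf : f ≠ 0) : 0 < ⟪P.green hP.bijective f, f⟫_ℝ :=
  inner_pos_of_eigenvalues (T := hP.greenCLM) hP.isCompactOperator_greenCLM hP.selfAdjoint
    (P.green_injective hP.bijective) (fun μ hμ => (hpos μ hμ).le) hf

end BoundaryValueProblem

end EllipticBVP

end

/-! ### The corollary -/

theorem corollary2p3 (n m : ℕ) (P : EllipticBVP.BoundaryValueProblem n m)
    (hP : P.IsAdmissible) (hpos : P.IsPositive hP) (hmn : (n : ℝ) / 2 < (m : ℝ))
    (f : EllipticBVP.L2 P.U) (hf : ∀ᵐ x ∂(volume.restrict P.U), 0 < f x)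
    (u : P.domain) (hu : P.op u = f) :
    0 < volume {x : EllipticBVP.E n | x ∈ P.U ∧ 0 < (u : EllipticBVP.L2 P.U) x} := by
  have hne : f ≠ 0 := by
    rintro rfl
    have hfalse : ∀ᵐ x ∂(volume.restrict P.U), False := by
      filter_upwards [hf, Lp.coeFn_zero ℝ 2 (volume.restrict P.U)] with x h1 h2
      rw [h2] at h1
      exact lt_irrefl _ h1
    rw [eventually_false_iff_eq_bot, ae_eq_bot, Measure.restrict_eq_zero] at hfalse
    exact (P.isOpen.measure_pos volume P.isConnected.nonempty).ne' hfalse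
  have h := hP.inner_green_pos hpos hne
  -- Since `G f = u`, positivity of the form now says `∫ u f > 0`.
  rw [← hu, P.green_op, hu, EllipticBVP.inner_eq_integral_mul] at h
  refine pos_iff_ne_zero.2 fun h0 => h.not_ge (integral_nonpos_of_ae ?_)
  have hle : ∀ᵐ x ∂(volume.restrict P.U), (u : EllipticBVP.L2 P.U) x ≤ 0 := by
    rw [ae_restrict_iff' P.isOpen.measurableSet, ae_iff]
    refine measure_mono_null (fun x hx => ?_) h0
    simpa using hx
  filter_upwards [hle, hf] with x h1 h2
  exact mul_nonpos_of_nonpos_of_nonneg h1 h2.le
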